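/- Call a set $\mathscr{B}$ of positive integers an Erdős set if it is infinite, primitive (no element divides another one), pairwise coprime, and $\sum_{b\in\mathscr{B}}1/b<\infty$. Let $\eta\in\{0,1\}^{\mathbb{Z}}$ be the characteristic function of the $\mathscr{B}$-free integers $\mathbb{Z}\setminus\bigcup_{b\in\mathscr{B}}b\mathbb{Z}$, let $S$ be the left shift, $(Sx)(n)=x(n+1)$, and let $X_\eta=\overline{\{S^r\eta : r\in\mathbb{Z}\}}\subset\{0,1\}^{\mathbb{Z}}$ (closure in the product topology) be the $\mathscr{B}$-free subshift. A cellular automaton (CA) on $X_\eta$ is a continuous map $\tau:X_\eta\to X_\eta$ with $\tau\circ S=S\circ\tau$. It is pre-injective if any $x,y\in X_\eta$ that differ in at most finitely many coordinates and satisfy $\tau(x)=\tau(y)$ are equal. Theorem. Let $\mathscr{B}$ be an Erdős set. Then $(X_\eta,S)$ satisfies the Garden of Eden theorem: a CA on $X_\eta$ is surjective if and only if it is pre-injective. Moreover, every CA $\tau$ on $X_\eta$ is given by a monotone code up to a power of the shift: there are $t\in\mathbb{Z}$, $\ell\ge 0$ and $\phi:\{0,1\}^{\{-\ell,\dots,\ell\}}\to\{0,1\}$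 with $\phi(B)\le B(0)$ for every block $B$, such that $\tau(x)=S^t y$ for all $x\in X_\eta$, where $y(n)=\phi\bigl(x(n-\ell),\dots,x(n+\ell)\bigr)$ for all $n\in\mathbb{Z}$. Finally, if a CA $\tau$ on $X_\eta$ is surjective, then $\tau=S^t$ on $X_\eta$ for some $t\in\mathbb{Z}$. -/

import Mathlib

open SymbolicDynamics SymbolicDynamics.FullShift

namespace BFree

/-- An Erdős set: an infinite set of positive integers that is primitive (no element divides
another one), pairwise coprime and thin (the sum of the reciprocals converges). -/
structure IsErdos (B : Set ℕ) : Prop where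
  pos : ∀ b ∈ B, 0 < b
  infinite : B.Infinite
  primitive : IsAntichain (· ∣ ·) B
  coprime : B.Pairwise Nat.Coprime
  thin : Summable fun b : B => (1 : ℝ) / (b : ℕ)

/-- The set of multiples `⋃ b ∈ B, b ℤ`. -/
def multiples (B : Set ℕ) : Set ℤ := {n | ∃ b ∈ B, (b : ℤ) ∣ n}

open Classical in
/-- The characteristic function of the `B`-free integers; `0` and `1` are `false` and `true`. -/
noncomputable def eta (B : Set ℕ) : ℤ → Bool := fun n => decide (n ∉ multiples B)

/-- The `B`-free subshift: the closure, in the product topology, of the two-sided orbit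
of `eta B`. Here `shift r x` is the sequence `n ↦ x (r + n)`. -/
noncomputable def freeSubshift (B : Set ℕ) : Subshift Bool ℤ where
  carrier := closure (Set.range fun r : ℤ => shift r (eta B))
  isClosed := isClosed_closure
  mapsTo := by
    intro g
    refine Set.MapsTo.closure ?_ (by fun_prop)
    rintro _ ⟨r, rfl⟩
    exact ⟨r + g, shift_add r g _⟩

/-- The `t`-th power, `t ∈ ℤ`, of the left shift, as a self-map of a subshift. -/
def shiftPow (X : Subshift Bool ℤ) (t : ℤ) : X.carrier → X.carrier :=
  (X.mapsTo t).restrict (shift t) X.carrier X.carrier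

/-- A cellular automaton on a subshift is an endomorphism: a continuous self-map that commutes
with the left shift. -/
structure IsCellularAutomaton (X : Subshift Bool ℤ) (τ : X.carrier → X.carrier) : Prop where
  continuous : Continuous τ
  comm : Function.Commute τ (shiftPow X 1)

/-- Two configurations that have the same image and differ in at most finitely many coordinates
are equal. -/
def IsPreInjective (X : Subshift Bool ℤ) (τ : X.carrier → X.carrier) : Prop :=
  ∀ x y : X.carrier, τ x = τ y → {n : ℤ | x.1 n ≠ y.1 n}.Finite → x = y

/-- The Garden of Eden theorem holds for the subshift `X`. -/
def SatisfiesGardenOfEden (X : Subshift Bool ℤ) : Prop :=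
  ∀ τ : X.carrier → X.carrier, IsCellularAutomaton X τ →
    (Function.Surjective τ ↔ IsPreInjective X τ)

/-- The blocks indexed by `{-ℓ, …, ℓ}`. -/
abbrev Block (ℓ : ℕ) : Type := Set.Icc (-(ℓ : ℤ)) (ℓ : ℤ) → Bool

/-- The central entry of a block. -/
def Block.center {ℓ : ℕ} (w : Block ℓ) : Bool := w ⟨0, by simp⟩

/-- A code is monotone if its value never exceeds the central entry of the block. -/
def IsMonotoneCode {ℓ : ℕ} (φ : Block ℓ → Bool) : Prop := ∀ w : Block ℓ, φ w ≤ w.center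

/-- The map on sequences given by the sliding block code `φ`. -/
def codeMap {ℓ : ℕ} (φ : Block ℓ → Bool) (x : ℤ → Bool) : ℤ → Bool :=
  fun n => φ fun i => x (n + (i : ℤ))

end BFree

namespace BFree

/-! A sieve shows that every block whose support misses a class modulo each `b ∈ B` occurs in `eta
B`, with the residue of its place modulo one chosen `b₀` prescribed (`exists_occurrence`). Hence the
subshift is the set of admissible sequences: it is hereditary, and `eta B` is maximal in it. For a
CA of radius `ℓ`, take `b₀ > 2ℓ` in `B`. The image of `eta B` misses a class modulo `b₀`. Placing
blocks of `x` in that class shows that a `1` of the image at `n` forces a `1` of `x` at `t + n`,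
with `t` fixed (`exists_shift_dominating`). After a shift, the CA becomes a map `σ` that only erases
`1`s. If `σ` is surjective, maximality makes it fix `eta B`; if it is pre-injective, it fixes all
finitely supported points. Either set of fixed points has dense orbits, so `σ` is the identity. -/

/-! ### Reciprocal tails, Chinese remainders, counting in progressions -/

theorem IsErdos.two_le {B : Set ℕ} (hB : IsErdos B) {b : ℕ} (hb : b ∈ B) : 2 ≤ b := by
  have hpos := hB.pos b hb
  by_contra h
  have h1 : b = 1 := by omega
  subst h1
  obtain ⟨c, hc, hlt⟩ := hB.infinite.exists_gt 1
  exact hB.primitive hb hc (by omega) (one_dvd c)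

theorem IsErdos.exists_sum_tail_lt {B : Set ℕ} (hB : IsErdos B) {ε : ℝ} (hε : 0 < ε) :
    ∃ K : ℕ, ∀ T : Finset ℕ, (∀ b ∈ T, b ∈ B ∧ K < b) → ∑ b ∈ T, (1 : ℝ) / b < ε := by
  have hs : Summable (B.indicator fun b : ℕ => (1 : ℝ) / b) :=
    summable_subtype_iff_indicator.1 hB.thin
  obtain ⟨s, hs⟩ := summable_iff_vanishing_norm.1 hs ε hε
  refine ⟨s.sup id, fun T hT => ?_⟩
  have hd : Disjoint T s := Finset.disjoint_left.2 fun b hb hbs =>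
    absurd (hT b hb).2 (not_lt.2 (Finset.le_sup (f := id) hbs))
  have h := (le_abs_self _).trans_lt (hs T hd)
  rwa [Finset.sum_congr rfl fun b hb => Set.indicator_of_mem (hT b hb).1 _] at h

theorem IsErdos.exists_crt {B : Set ℕ} (hB : IsErdos B) (c : ℕ → ℤ) (T : Finset ℕ)
    (hT : ∀ b ∈ T, b ∈ B) : ∃ r : ℕ, ∀ b ∈ T, (b : ℤ) ∣ r - c b := by
  obtain ⟨r, hr⟩ := Nat.chineseRemainderOfFinset (fun b => (c b % b).toNat) (fun b : ℕ => b) T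
    (fun b hb => (hB.pos b (hT b hb)).ne')
    (fun a ha b hb hab => hB.coprime (hT a ha) (hT b hb) hab)
  refine ⟨r, fun b hb => ?_⟩
  have hb0 : (b : ℤ) ≠ 0 := by exact_mod_cast (hB.pos b (hT b hb)).ne'
  have h := (Int.natCast_modEq_iff.2 (hr b hb)).dvd
  rw [Int.toNat_of_nonneg (Int.emod_nonneg _ hb0)] at h
  have h2 : (b : ℤ) ∣ c b - c b % b := Int.dvd_self_sub_emod
  have h3 := dvd_neg.2 (dvd_add h h2)
  exact (h3).trans (dvd_of_eq (by ring))

theorem card_filter_dvd_le {b M : ℕ} (hb : 0 < b) (hco : Nat.Coprime b M) (a : ℤ) (N : ℕ) :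
    (((Finset.range N).filter fun s : ℕ => (b : ℤ) ∣ a + M * s).card : ℝ) ≤ N / b + 1 := by
  rcases ((Finset.range N).filter fun s : ℕ => (b : ℤ) ∣ a + M * s).eq_empty_or_nonempty
    with h | ⟨v, hv⟩
  · rw [h]
    simp only [Finset.card_empty, Nat.cast_zero]
    positivity
  · have hv := (Finset.mem_filter.1 hv).2
    have hsub : ((Finset.range N).filter fun s : ℕ => (b : ℤ) ∣ a + M * s) ⊆
        (Finset.range N).filter fun s : ℕ => s ≡ v [MOD b] := by
      intro s hs
      obtain ⟨hsN, hs⟩ := Finset.mem_filter.1 hs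
      refine Finset.mem_filter.2 ⟨hsN, ?_⟩
      have h1 : (b : ℤ) ∣ M * ((v : ℤ) - s) := by
        exact (dvd_sub hv hs).trans (dvd_of_eq (by ring))
      exact Int.natCast_modEq_iff.1
        (Int.modEq_iff_dvd.2 ((Nat.isCoprime_iff_coprime.2 hco).dvd_of_dvd_mul_left h1))
    have hcard := Finset.card_le_card hsub
    rw [← Nat.count_eq_card_filter_range (· ≡ v [MOD b]), Nat.count_modEq_card _ hb] at hcard
    have h2 : (N / b + if v % b < N % b then 1 else 0) ≤ N / b + 1 := by split_ifs <;> omega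
    calc _ ≤ ((N / b + 1 : ℕ) : ℝ) := by exact_mod_cast hcard.trans h2
      _ ≤ N / b + 1 := by
        push_cast
        gcongr
        exact Nat.cast_div_le

/-! ### The sieve and the occurrence of admissible blocks -/

open Classical in
-- A union bound over `s < N`: since `n < q`, the numbers tested lie in `[1, C * N]`, so only `b ≤ C
-- * N` matter. For each `j`, the `b ≤ K₂` and the `b > K₂` together exclude at most `3N/(4D)`
-- values, and `J.card < D`.
theorem IsErdos.exists_not_dvd {B : Set ℕ} (hB : IsErdos B) (J : Finset ℤ) {K M q n : ℕ}
    (hK : ∀ T : Finset ℕ, (∀ b ∈ T, b ∈ B ∧ K < b) →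
      ∑ b ∈ T, (1 : ℝ) / b < 1 / (4 * (J.card + 1)))
    (hco : ∀ b ∈ B, K < b → Nat.Coprime b M) (hJn : ∀ j ∈ J, j.natAbs ≤ n) (hq : n < q) :
    ∃ s : ℕ, ∀ j ∈ J, ∀ b ∈ B, K < b → ¬ (b : ℤ) ∣ (q + j : ℤ) + M * s := by
  obtain ⟨D, hD⟩ : ∃ D : ℕ, D = J.card + 1 := ⟨_, rfl⟩
  have hDR : (D : ℝ) = J.card + 1 := by rw [hD]; push_cast; rfl
  rw [← hDR] at hK
  have hD0 : (0 : ℝ) < D := by rw [hDR]; positivity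
  obtain ⟨C, hC⟩ : ∃ C : ℕ, C = q + M + n := ⟨_, rfl⟩
  obtain ⟨K₂, hK₂⟩ := hB.exists_sum_tail_lt (ε := 1 / (4 * D * (C + 1))) (by positivity)
  -- With this `N`, the rounding errors `+1` from the `b ≤ K₂` total at most `K₂ + 1 = N/(4D)`.
  obtain ⟨N, hN⟩ : ∃ N : ℕ, N = 4 * D * (K₂ + 1) := ⟨_, rfl⟩
  have hN1 : 1 ≤ N := by
    rw [hN, hD]
    exact Nat.mul_pos (by omega) (by omega)
  by_contra! hcon
  let T₁ := (Finset.range (K₂ + 1)).filter (fun b => b ∈ B ∧ K < b)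
  let T₂ := (Finset.range (C * N + 1)).filter (fun b => b ∈ B ∧ K < b ∧ K₂ < b)
  let F : ℤ → ℕ → Finset ℕ := fun j b =>
    (Finset.range N).filter fun s : ℕ => (b : ℤ) ∣ (q + j : ℤ) + M * s
  have hcover : Finset.range N ⊆ J.biUnion fun j => (T₁ ∪ T₂).biUnion fun b => F j b := by
    intro s hs
    obtain ⟨j, hj, b, hb, hKb, hdvd⟩ := hcon s
    have hjn := hJn j hj
    have hbC : b ≤ C * N := by
      have hMs : (0 : ℤ) ≤ M * s := by positivity
      have hle := Int.le_of_dvd (by omega) hdvd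
      have hsN : M * s ≤ M * N := Nat.mul_le_mul_left _ (Finset.mem_range.1 hs).le
      have hsN' : (M * s : ℤ) ≤ M * N := by exact_mod_cast hsN
      have h1 : (b : ℤ) ≤ q + M * N + n := by omega
      have h2 : b ≤ q + M * N + n := by exact_mod_cast h1
      calc b ≤ q * 1 + M * N + n * 1 := by omega
        _ ≤ q * N + M * N + n * N := by gcongr
        _ = C * N := by rw [hC]; ring
    refine Finset.mem_biUnion.2 ⟨j, hj, Finset.mem_biUnion.2 ⟨b, ?_,
      Finset.mem_filter.2 ⟨hs, hdvd⟩⟩⟩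
    by_cases h : b ≤ K₂
    · exact Finset.mem_union_left _
        (Finset.mem_filter.2 ⟨Finset.mem_range.2 (by omega), hb, hKb⟩)
    · exact Finset.mem_union_right _
        (Finset.mem_filter.2 ⟨Finset.mem_range.2 (by omega), hb, hKb, by omega⟩)
  have hcount : ∀ j, ∀ b ∈ B, K < b → ((F j b).card : ℝ) ≤ N / b + 1 := fun j b hb hKb =>
    card_filter_dvd_le (hB.pos b hb) (hco b hb hKb) _ _
  have hmem₁ : ∀ b ∈ T₁, b ∈ B ∧ K < b := fun b hb => (Finset.mem_filter.1 hb).2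
  have hmem₂ : ∀ b ∈ T₂, b ∈ B ∧ K < b ∧ K₂ < b := fun b hb => (Finset.mem_filter.1 hb).2
  have hle₂ : ∀ b ∈ T₂, b ≤ C * N := fun b hb =>
    Nat.lt_succ_iff.1 (Finset.mem_range.1 (Finset.mem_filter.1 hb).1)
  have hcard₁ : (T₁.card : ℝ) ≤ K₂ + 1 := by
    have : T₁.card ≤ _ := Finset.card_filter_le _ _
    rw [Finset.card_range] at this
    exact_mod_cast this
  have h1 : N ≤ ∑ j ∈ J, (∑ b ∈ T₁, (F j b).card + ∑ b ∈ T₂, (F j b).card) := by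
    calc N = (Finset.range N).card := (Finset.card_range N).symm
      _ ≤ _ := Finset.card_le_card hcover
      _ ≤ _ := Finset.card_biUnion_le
      _ ≤ _ := Finset.sum_le_sum fun j _ => by
        rw [Finset.union_biUnion]
        exact (Finset.card_union_le _ _).trans
          (add_le_add Finset.card_biUnion_le Finset.card_biUnion_le)
  clear_value T₁ T₂ F
  have hsum₁ : ∀ j, ∑ b ∈ T₁, ((F j b).card : ℝ) ≤ N * (1 / (4 * D)) + (K₂ + 1) := by
    intro j
    calc ∑ b ∈ T₁, ((F j b).card : ℝ) ≤ ∑ b ∈ T₁, (N * (1 / (b : ℝ)) + 1) :=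
          Finset.sum_le_sum fun b hb => by
            have := hcount j b (hmem₁ b hb).1 (hmem₁ b hb).2
            rwa [mul_one_div]
      _ = N * ∑ b ∈ T₁, 1 / (b : ℝ) + T₁.card := by
          rw [Finset.sum_add_distrib, Finset.mul_sum, Finset.sum_const, nsmul_one]
      _ ≤ _ := add_le_add (mul_le_mul_of_nonneg_left (hK T₁ hmem₁).le (Nat.cast_nonneg N)) hcard₁
  have hsum₂ : ∀ j, ∑ b ∈ T₂, ((F j b).card : ℝ) ≤ N * (1 / (4 * D)) := by
    intro j
    calc ∑ b ∈ T₂, ((F j b).card : ℝ) ≤ ∑ b ∈ T₂, ((C + 1) * N * (1 / (b : ℝ))) :=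
          Finset.sum_le_sum fun b hb => by
            have h1 := hcount j b (hmem₂ b hb).1 (hmem₂ b hb).2.1
            have hb0 : (0 : ℝ) < b := by exact_mod_cast hB.pos b (hmem₂ b hb).1
            have h3 : (b : ℝ) ≤ C * N := by exact_mod_cast hle₂ b hb
            -- For `b > K₂` the rounding error is absorbed into a multiple of `N / b`; this is why
            -- the tail tolerance has the factor `C + 1`.
            have h4 : (1 : ℝ) ≤ C * N / b := (one_le_div hb0).2 h3
            calc _ ≤ _ := h1
              _ ≤ (N : ℝ) / b + C * N / b := by gcongr
              _ = _ := by ring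
      _ = (C + 1) * N * ∑ b ∈ T₂, 1 / (b : ℝ) := by rw [Finset.mul_sum]
      _ ≤ (C + 1) * N * (1 / (4 * D * (C + 1))) :=
          mul_le_mul_of_nonneg_left
            (hK₂ T₂ fun b hb => ⟨(hmem₂ b hb).1, (hmem₂ b hb).2.2⟩).le (by positivity)
      _ = _ := by field_simp
  have hfinal : (N : ℝ) ≤ J.card * (N * (1 / (4 * D)) + (K₂ + 1) + N * (1 / (4 * D))) := by
    calc (N : ℝ) ≤ ∑ j ∈ J, (∑ b ∈ T₁, ((F j b).card : ℝ) + ∑ b ∈ T₂, ((F j b).card : ℝ)) := by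
          exact_mod_cast h1
      _ ≤ ∑ j ∈ J, ((N : ℝ) * (1 / (4 * D)) + (K₂ + 1) + N * (1 / (4 * D))) :=
          Finset.sum_le_sum fun j _ => add_le_add (hsum₁ j) (hsum₂ j)
      _ = _ := by rw [Finset.sum_const, nsmul_eq_mul]
  have hNval : (N : ℝ) * (1 / (4 * D)) = K₂ + 1 := by
    rw [hN]
    push_cast
    field_simp
  have hNval' : (N : ℝ) = 4 * (J.card + 1) * (K₂ + 1) := by
    rw [hN, ← hDR]
    push_cast
    ring
  rw [hNval, hNval'] at hfinal
  have h0 : (0 : ℝ) ≤ J.card * (K₂ + 1) := by positivity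
  have h2 : (0 : ℝ) ≤ K₂ := by positivity
  linarith

open Classical in
/-- A sieve: residues modulo the small elements of `B` may be prescribed for an integer `r` all of
whose translates by the elements of a finite set `J` are `B`-free. -/
theorem IsErdos.exists_forall_add_notMem_multiples {B : Set ℕ} (hB : IsErdos B) (J : Finset ℤ)
    (c : ℕ → ℤ) (hc : ∀ b ∈ B, ∀ j ∈ J, ¬ (b : ℤ) ∣ c b + j) (K₀ : ℕ) :
    ∃ r : ℤ, (∀ b ∈ B, b ≤ K₀ → (b : ℤ) ∣ r - c b) ∧ ∀ j ∈ J, r + j ∉ multiples B := by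
  obtain ⟨K₁, hK₁⟩ := hB.exists_sum_tail_lt (ε := 1 / (4 * ((J.card : ℝ) + 1))) (by positivity)
  obtain ⟨K, hK⟩ : ∃ K, K = max K₀ K₁ := ⟨_, rfl⟩
  obtain ⟨S, hS⟩ : ∃ S : Finset ℕ, ∀ b, b ∈ S ↔ b ∈ B ∧ b ≤ K :=
    ⟨(Finset.range (K + 1)).filter (· ∈ B), fun b => by
      rw [Finset.mem_filter, Finset.mem_range, Nat.lt_succ_iff, and_comm]⟩
  obtain ⟨r₀, hr₀⟩ := hB.exists_crt c S fun b hb => ((hS b).1 hb).1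
  obtain ⟨M, hM⟩ : ∃ M, M = ∏ b ∈ S, b := ⟨_, rfl⟩
  have hM0 : 1 ≤ M := hM ▸ Finset.prod_pos fun b hb => hB.pos b ((hS b).1 hb).1
  obtain ⟨n, hJn⟩ : ∃ n : ℕ, ∀ j ∈ J, j.natAbs ≤ n :=
    ⟨J.sup Int.natAbs, fun j hj => Finset.le_sup hj⟩
  have hn : n + 1 ≤ M * (n + 1) := Nat.le_mul_of_pos_left _ hM0
  -- Adding multiples of `M` keeps the residues of `r₀`; `M * (n + 1)` makes the start exceed `n`.
  obtain ⟨s, hs⟩ := hB.exists_not_dvd J (K := K) (M := M) (q := r₀ + M * (n + 1)) (n := n)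
    (fun T hT => hK₁ T fun b hb => ⟨(hT b hb).1, (hK ▸ le_max_right K₀ K₁).trans_lt (hT b hb).2⟩)
    (fun b hb hKb => hM ▸ Nat.Coprime.prod_right fun a ha => hB.coprime hb ((hS a).1 ha).1 (by
      have := ((hS a).1 ha).2
      omega)) hJn (by omega)
  have hmod : ∀ b ∈ B, b ≤ K →
      (b : ℤ) ∣ (((r₀ + M * (n + 1) : ℕ) : ℤ) + M * s) - c b := by
    intro b hb hbK
    have hbS : b ∈ S := (hS b).2 ⟨hb, hbK⟩
    have h1 : (b : ℤ) ∣ M := by exact_mod_cast hM ▸ Finset.dvd_prod_of_mem _ hbS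
    have h2 := dvd_add (hr₀ b hbS) (h1.mul_right (n + 1 + s))
    exact (h2).trans (dvd_of_eq (by push_cast; ring))
  refine ⟨_, fun b hb hbK => hmod b hb (hbK.trans (hK ▸ le_max_left _ _)), ?_⟩
  rintro j hj ⟨b, hb, hd⟩
  by_cases h : K < b
  · refine hs j hj b hb h ?_
    exact (hd).trans (dvd_of_eq (by ring))
  · refine hc b hb j hj ?_
    exact (dvd_sub hd (hmod b hb (not_lt.1 h))).trans (dvd_of_eq (by ring))

open Classical in
/-- Every admissible block occurs in `eta B`, at a place whose residue modulo a given element of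
`B` can be prescribed. -/
theorem IsErdos.exists_occurrence {B : Set ℕ} (hB : IsErdos B) (x : ℤ → Bool) (n : ℕ) (c : ℕ → ℤ)
    (hc : ∀ b ∈ B, ∀ j : ℤ, j.natAbs ≤ n → x j = true → ¬ (b : ℤ) ∣ c b + j) (b₀ : ℕ)
    (hb₀ : b₀ ∈ B) :
    ∃ r : ℤ, (b₀ : ℤ) ∣ r - c b₀ ∧ ∀ j : ℤ, j.natAbs ≤ n → eta B (r + j) = x j := by
  -- Each zero `i` of the block gets its own modulus `f i`, with residue `-i`, so that `f i ∣ r +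
  -- i`. As `f i > 2 * n`, it divides `r + j` for no other `j` of the window; as `f i > b₀`, the
  -- residue modulo `b₀` stays free.
  have hinf : (B \ Set.Iic (max b₀ (2 * n))).Infinite :=
    hB.infinite.sdiff (Set.finite_Iic _)
  set β : ℕ → ℕ := fun k => (hinf.natEmbedding _ k : ℕ) with hβ
  have hβinj : Function.Injective β :=
    Subtype.val_injective.comp (hinf.natEmbedding _).injective
  have hβB : ∀ k, β k ∈ B := fun k => (hinf.natEmbedding _ k).2.1
  have hβlt : ∀ k, max b₀ (2 * n) < β k := fun k => not_le.1 (hinf.natEmbedding _ k).2.2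
  set f : ℤ → ℕ := fun j => β (j + n).toNat with hf
  set Z : Finset ℤ := (Finset.Icc (-(n : ℤ)) n).filter (fun j => x j = false) with hZ
  set J : Finset ℤ := (Finset.Icc (-(n : ℤ)) n).filter (fun j => x j = true) with hJ
  have hfinj : ∀ i ∈ Z, ∀ j ∈ Z, f i = f j → i = j := by
    intro i hi j hj hij
    have h := hβinj hij
    have hi := Finset.mem_Icc.1 (Finset.mem_filter.1 hi).1
    have hj := Finset.mem_Icc.1 (Finset.mem_filter.1 hj).1
    omega
  set c' : ℕ → ℤ := fun b => if h : ∃ i ∈ Z, f i = b then -h.choose else c b with hc'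
  have hc'Z : ∀ i ∈ Z, c' (f i) = -i := by
    intro i hi
    have h : ∃ k ∈ Z, f k = f i := ⟨i, hi, rfl⟩
    rw [hc']
    simp only [dif_pos h]
    rw [hfinj _ h.choose_spec.1 _ hi h.choose_spec.2]
  have hc'N : ∀ b, (¬ ∃ i ∈ Z, f i = b) → c' b = c b := fun b h => dif_neg h
  have hadm : ∀ b ∈ B, ∀ j ∈ J, ¬ (b : ℤ) ∣ c' b + j := by
    intro b hb j hj
    obtain ⟨hjI, hxj⟩ := Finset.mem_filter.1 hj
    have hjI := Finset.mem_Icc.1 hjI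
    by_cases h : ∃ i ∈ Z, f i = b
    · obtain ⟨i, hi, rfl⟩ := h
      rw [hc'Z i hi]
      obtain ⟨hiI, hxi⟩ := Finset.mem_filter.1 hi
      have hiI := Finset.mem_Icc.1 hiI
      intro hd
      have hij : i ≠ j := by
        rintro rfl
        simp [hxi] at hxj
      have hlt : max b₀ (2 * n) < f i := hβlt _
      have := Int.natAbs_le_of_dvd_ne_zero hd (by omega)
      omega
    · rw [hc'N b h]
      exact hc b hb j (by omega) hxj
  obtain ⟨r, hr, hfree⟩ := hB.exists_forall_add_notMem_multiples J c' hadm (max b₀ (Z.sup f))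
  refine ⟨r, ?_, fun j hj => ?_⟩
  · rw [← hc'N b₀ ?_]
    · exact hr b₀ hb₀ (le_max_left _ _)
    · rintro ⟨i, -, hi⟩
      have hlt : max b₀ (2 * n) < f i := hβlt _
      omega
  · have hjI : j ∈ Finset.Icc (-(n : ℤ)) n := Finset.mem_Icc.2 (by omega)
    cases hx : x j with
    | true => exact decide_eq_true (hfree j (Finset.mem_filter.2 ⟨hjI, hx⟩))
    | false =>
      have hjZ : j ∈ Z := Finset.mem_filter.2 ⟨hjI, hx⟩
      refine decide_eq_false (not_not.2 ⟨f j, hβB _, ?_⟩)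
      have h := hr (f j) (hβB _) ((Finset.le_sup hjZ).trans (le_max_right _ _))
      rwa [hc'Z j hjZ, sub_neg_eq_add] at h


/-! ### Admissibility, heredity, maximality of `eta B` -/

theorem eta_eq_true_iff {B : Set ℕ} {n : ℤ} : eta B n = true ↔ n ∉ multiples B := by
  simp [eta]

theorem mem_closure_iff_forall_window {S : Set (ℤ → Bool)} {x : ℤ → Bool} :
    x ∈ closure S ↔ ∀ n : ℕ, ∃ y ∈ S, ∀ j : ℤ, j.natAbs ≤ n → y j = x j := by
  constructor
  · intro hx n
    obtain ⟨y, hy, hyS⟩ := mem_closure_iff.1 hx _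
      (isOpen_cylinder (Finset.Icc (-(n : ℤ)) n) x) (fun _ _ => rfl)
    exact ⟨y, hyS, fun j hj => hy j (Finset.mem_Icc.2 (by omega))⟩
  · intro h
    choose y hyS hy using h
    refine mem_closure_of_tendsto (f := y) (b := Filter.atTop) ?_ (Filter.Eventually.of_forall hyS)
    refine tendsto_pi_nhds.2 fun j => tendsto_const_nhds.congr' ?_
    filter_upwards [Filter.eventually_ge_atTop j.natAbs] with n hn
    exact (hy n j hn).symm

/-- The `B`-free subshift of an Erdős set consists of the admissible sequences: those whose support
misses a residue class modulo each element of `B`. -/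
theorem IsErdos.mem_freeSubshift_iff {B : Set ℕ} (hB : IsErdos B) {x : ℤ → Bool} :
    x ∈ (freeSubshift B).carrier ↔
      ∀ b ∈ B, ∃ c : ℤ, ∀ n, x n = true → ¬ (b : ℤ) ∣ c + n := by
  constructor
  · intro hx b hb
    have hb0 : (b : ℤ) ≠ 0 := by exact_mod_cast (hB.pos b hb).ne'
    -- Missing some class modulo `b` is a closed condition, being a finite union over the classes,
    -- and the orbit of `eta B` satisfies it.
    have hcl : IsClosed (⋃ c ∈ Finset.range b, ⋂ n : ℤ,
        {x : ℤ → Bool | x n = true → ¬ (b : ℤ) ∣ (c : ℤ) + n}) := by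
      refine isClosed_biUnion_finset fun c _ => isClosed_iInter fun n => ?_
      exact IsClosed.preimage (f := fun x : ℤ → Bool => x n) (continuous_apply n)
        (isClosed_discrete {v : Bool | v = true → ¬ (b : ℤ) ∣ (c : ℤ) + n})
    have hsub := hcl.closure_subset_iff (s := Set.range fun r : ℤ => shift r (eta B)) |>.2 (by
      rintro _ ⟨r, rfl⟩
      have h0 := Int.emod_nonneg r hb0
      have h1 := Int.emod_lt_of_pos r (by have := hB.pos b hb; omega : (0 : ℤ) < b)
      refine Set.mem_biUnion (x := (r % b).toNat) (Finset.mem_range.2 (by omega)) ?_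
      refine Set.mem_iInter.2 fun n hn hd => eta_eq_true_iff.1 hn ⟨b, hb, ?_⟩
      rw [Int.toNat_of_nonneg h0] at hd
      exact (dvd_add (Int.dvd_self_sub_emod (x := r) (m := b)) hd).trans (dvd_of_eq (by ring)))
    obtain ⟨c, -, hc⟩ := Set.mem_iUnion₂.1 (hsub hx)
    exact ⟨c, fun n => Set.mem_iInter.1 hc n⟩
  · intro h
    choose! c hc using h
    obtain ⟨b₀, hb₀⟩ := hB.infinite.nonempty
    refine mem_closure_iff_forall_window.2 fun n => ?_
    obtain ⟨r, -, hr⟩ := hB.exists_occurrence x n c (fun b hb j _ hj => hc b hb j hj) b₀ hb₀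
    exact ⟨_, ⟨r, rfl⟩, hr⟩

theorem IsErdos.mem_freeSubshift_of_le {B : Set ℕ} (hB : IsErdos B) {x y : ℤ → Bool}
    (hx : x ∈ (freeSubshift B).carrier) (hyx : ∀ n, y n = true → x n = true) :
    y ∈ (freeSubshift B).carrier := by
  rw [hB.mem_freeSubshift_iff] at hx ⊢
  intro b hb
  obtain ⟨c, hc⟩ := hx b hb
  exact ⟨c, fun n hn => hc n (hyx n hn)⟩

/-- `eta B` as a point of the `B`-free subshift. -/
noncomputable def etaPoint (B : Set ℕ) : (freeSubshift B).carrier :=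
  ⟨eta B, subset_closure ⟨0, shift_zero _⟩⟩

/-- `eta B` is a maximal element of the `B`-free subshift. -/
theorem IsErdos.eq_etaPoint_of_le {B : Set ℕ} (hB : IsErdos B) {x : (freeSubshift B).carrier}
    (hx : ∀ n, eta B n = true → x.1 n = true) : x = etaPoint B := by
  refine Subtype.ext (funext fun m => ?_)
  change x.1 m = eta B m
  rw [Bool.eq_iff_iff]
  refine ⟨fun hm => eta_eq_true_iff.2 ?_, hx m⟩
  rintro ⟨b, hb, hbm⟩
  obtain ⟨c, hc⟩ := hB.mem_freeSubshift_iff.1 x.2 b hb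
  by_cases hbc : (b : ℤ) ∣ c
  · exact hc m hm (dvd_add hbc hbm)
  -- Were the missed class not `0`, it would contain a `B`-free integer `r`, where `x` must be `1`.
  -- For the other moduli any nonzero residue serves.
  · obtain ⟨r, hr, hr'⟩ := hB.exists_occurrence (fun _ => true) 0
      (fun b' => if b' = b then -c else 1) (by
        intro b' hb' j hj _ hd
        obtain rfl : j = 0 := by omega
        rw [add_zero] at hd
        split_ifs at hd with h
        · exact hbc (h ▸ (dvd_neg.1 hd))
        · have := Int.le_of_dvd one_pos hd
          have := hB.two_le hb'
          omega) b hb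
    have h := hr' 0 (by simp)
    rw [add_zero] at h
    refine hc r (hx r h) ?_
    simpa [add_comm] using hr

/-! ### Shift powers and cellular automata -/

theorem shiftPow_add (X : Subshift Bool ℤ) (s t : ℤ) (x : X.carrier) :
    shiftPow X (s + t) x = shiftPow X t (shiftPow X s x) :=
  Subtype.ext (shift_add s t x.1)

theorem shiftPow_zero (X : Subshift Bool ℤ) (x : X.carrier) : shiftPow X 0 x = x :=
  Subtype.ext (shift_zero x.1)

theorem shiftPow_neg_shiftPow (X : Subshift Bool ℤ) (t : ℤ) (x : X.carrier) :
    shiftPow X (-t) (shiftPow X t x) = x := by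
  rw [← shiftPow_add, add_neg_cancel, shiftPow_zero]

theorem shiftPow_shiftPow_neg (X : Subshift Bool ℤ) (t : ℤ) (x : X.carrier) :
    shiftPow X t (shiftPow X (-t) x) = x := by
  rw [← shiftPow_add, neg_add_cancel, shiftPow_zero]

theorem continuous_shiftPow (X : Subshift Bool ℤ) (t : ℤ) : Continuous (shiftPow X t) :=
  (continuous_shift t).restrict _

namespace IsCellularAutomaton

variable {X : Subshift Bool ℤ} {τ : X.carrier → X.carrier}

theorem map_shiftPow (hτ : IsCellularAutomaton X τ) (t : ℤ) (x : X.carrier) :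
    τ (shiftPow X t x) = shiftPow X t (τ x) := by
  induction t with
  | zero => rw [shiftPow_zero, shiftPow_zero]
  | succ n ih => rw [shiftPow_add, hτ.comm.eq, ih, ← shiftPow_add]
  | pred n ih =>
    have h : shiftPow X (-n) x = shiftPow X 1 (shiftPow X (-n - 1) x) := by
      rw [← shiftPow_add, sub_add_cancel]
    rw [h, hτ.comm.eq] at ih
    rw [← shiftPow_neg_shiftPow X 1 (τ (shiftPow X (-n - 1) x)), ih, ← shiftPow_add,
      ← sub_eq_add_neg]

theorem shiftPow_comp (hτ : IsCellularAutomaton X τ) (t : ℤ) :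
    IsCellularAutomaton X (shiftPow X t ∘ τ) where
  continuous := (continuous_shiftPow X t).comp hτ.continuous
  comm x := by
    change shiftPow X t (τ (shiftPow X 1 x)) = shiftPow X 1 (shiftPow X t (τ x))
    rw [hτ.map_shiftPow, ← shiftPow_add, ← shiftPow_add, add_comm]

/-- A cellular automaton is a sliding block code: the Curtis–Hedlund–Lyndon theorem. -/
theorem exists_window (hτ : IsCellularAutomaton X τ) :
    ∃ ℓ : ℕ, ∀ (x y : X.carrier) (n : ℤ),
      (∀ j : ℤ, j.natAbs ≤ ℓ → x.1 (n + j) = y.1 (n + j)) → (τ x).1 n = (τ y).1 n := by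
  have : CompactSpace X.carrier := isCompact_iff_compactSpace.1 X.isClosed.isCompact
  have hopen : ∀ x : X.carrier, ∃ ℓ : ℕ, ∀ y : X.carrier,
      (∀ j : ℤ, j.natAbs ≤ ℓ → y.1 j = x.1 j) → (τ y).1 0 = (τ x).1 0 := by
    intro x
    by_contra! h
    choose y hy hne using h
    have hlim : Filter.Tendsto y Filter.atTop (nhds x) := by
      refine tendsto_subtype_rng.2 (tendsto_pi_nhds.2 fun j => tendsto_const_nhds.congr' ?_)
      filter_upwards [Filter.eventually_ge_atTop j.natAbs] with n hn
      exact (hy n j hn).symm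
    have hcont : Continuous fun x : X.carrier => (τ x).1 0 :=
      (continuous_apply 0).comp (continuous_subtype_val.comp hτ.continuous)
    have hev := ((hcont.tendsto x).comp hlim).eventually
      ((isOpen_discrete {(τ x).1 0}).mem_nhds rfl)
    obtain ⟨n, hn⟩ := hev.exists
    exact hne n hn
  choose L hL using hopen
  obtain ⟨s, hs⟩ := isCompact_univ.elim_finite_subcover
    (fun x : X.carrier => Subtype.val ⁻¹' cylinder (Finset.Icc (-(L x : ℤ)) (L x)) x.1)
    (fun x => (isOpen_cylinder _ _).preimage continuous_subtype_val)
    (fun x _ => Set.mem_iUnion.2 ⟨x, fun _ _ => rfl⟩)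
  have hzero : ∀ x y : X.carrier, (∀ j : ℤ, j.natAbs ≤ s.sup L → x.1 j = y.1 j) →
      (τ x).1 0 = (τ y).1 0 := by
    intro x y hxy
    obtain ⟨z, hz, hxz⟩ := Set.mem_iUnion₂.1 (hs (Set.mem_univ x))
    have hxz' : ∀ j : ℤ, j.natAbs ≤ L z → x.1 j = z.1 j := fun j hj =>
      hxz j (Finset.mem_Icc.2 (by omega))
    rw [hL z x hxz', hL z y fun j hj => ?_]
    rw [← hxz' j hj, hxy j (hj.trans (Finset.le_sup hz))]
  refine ⟨s.sup L, fun x y n hxy => ?_⟩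
  have h := hzero (shiftPow X n x) (shiftPow X n y) hxy
  rw [hτ.map_shiftPow, hτ.map_shiftPow] at h
  change (τ x).1 (n + 0) = (τ y).1 (n + 0) at h
  rwa [add_zero] at h

/-- A cellular automaton that fixes configurations agreeing with any given one on arbitrarily large
windows is the identity. -/
theorem eq_id_of_forall_window (hτ : IsCellularAutomaton X τ)
    (h : ∀ (x : X.carrier) (n : ℕ), ∃ y : X.carrier, τ y = y ∧
      ∀ j : ℤ, j.natAbs ≤ n → y.1 j = x.1 j) : ∀ x, τ x = x := by
  obtain ⟨ℓ, hℓ⟩ := hτ.exists_window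
  intro x
  refine Subtype.ext (funext fun n => ?_)
  obtain ⟨y, hy, hyx⟩ := h x (n.natAbs + ℓ)
  rw [hℓ x y n fun j hj => (hyx _ (by omega)).symm, hy, hyx n (by omega)]

end IsCellularAutomaton

/-- Up to a power of the shift, a cellular automaton on the `B`-free subshift does not create
symbols `1`. -/
theorem IsErdos.exists_shift_dominating {B : Set ℕ} (hB : IsErdos B)
    {τ : (freeSubshift B).carrier → (freeSubshift B).carrier}
    (hτ : IsCellularAutomaton (freeSubshift B) τ) :
    ∃ t : ℤ, ∀ (x : (freeSubshift B).carrier) (n : ℤ), (τ x).1 n = true → x.1 (t + n) = true := by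
  obtain ⟨ℓ, hℓ⟩ := hτ.exists_window
  obtain ⟨b₀, hb₀, hlt⟩ := hB.infinite.exists_gt (2 * ℓ)
  obtain ⟨c₀, hc₀⟩ := hB.mem_freeSubshift_iff.1 (τ (etaPoint B)).2 b₀ hb₀
  have key : ∀ x : (freeSubshift B).carrier, (τ x).1 0 = true →
      ∃ j : ℤ, j.natAbs ≤ ℓ ∧ x.1 j = true ∧ (b₀ : ℤ) ∣ -c₀ + j := by
    intro x hx
    by_contra! hcon
    -- Otherwise the window of `x` occurs in `eta B` at some `r` congruent to `-c₀`, and the image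
    -- of `eta B` has a `1` in its missed class.
    have hadm := hB.mem_freeSubshift_iff.1 x.2
    choose! c hc using hadm
    obtain ⟨r, hr, hr'⟩ := hB.exists_occurrence x.1 ℓ (fun b => if b = b₀ then -c₀ else c b) (by
      intro b hb j hj hxj
      split_ifs with h
      · exact h ▸ hcon j hj hxj
      · exact hc b hb j hxj) b₀ hb₀
    have h := hℓ (shiftPow (freeSubshift B) r (etaPoint B)) x 0 fun j hj => by
      rw [zero_add]
      exact hr' j hj
    rw [hτ.map_shiftPow, hx] at h
    change (τ (etaPoint B)).1 (r + 0) = true at h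
    rw [add_zero] at h
    refine hc₀ r h ?_
    simpa [add_comm] using hr
  obtain ⟨t, ht⟩ : ∃ t : ℤ, ∀ j : ℤ, j.natAbs ≤ ℓ → (b₀ : ℤ) ∣ -c₀ + j → j = t := by
    by_cases h : ∃ t : ℤ, t.natAbs ≤ ℓ ∧ (b₀ : ℤ) ∣ -c₀ + t
    · obtain ⟨t, htℓ, ht⟩ := h
      refine ⟨t, fun j hj hd => ?_⟩
      by_contra hne
      have hd' : (b₀ : ℤ) ∣ j - t := (dvd_sub hd ht).trans (dvd_of_eq (by ring))
      have := Int.natAbs_le_of_dvd_ne_zero hd' (by omega)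
      omega
    -- Here the image is always zero, so any `t` will do.
    · exact ⟨0, fun j hj hd => absurd ⟨j, hj, hd⟩ h⟩
  refine ⟨t, fun x n hn => ?_⟩
  obtain ⟨j, hj, hxj, hd⟩ := key (shiftPow (freeSubshift B) n x) (by
    rw [hτ.map_shiftPow]
    change (τ x).1 (n + 0) = true
    rwa [add_zero])
  obtain rfl := ht j hj hd
  rw [add_comm]
  exact hxj

/-! ### Cellular automata that only erase `1`s -/

section Decreasing

variable {B : Set ℕ} {σ : (freeSubshift B).carrier → (freeSubshift B).carrier}

theorem IsErdos.eq_id_of_surjective (hB : IsErdos B) (hσ : IsCellularAutomaton (freeSubshift B) σ)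
    (hle : ∀ x n, (σ x).1 n = true → x.1 n = true) (hsurj : Function.Surjective σ) :
    ∀ x, σ x = x := by
  obtain ⟨z, hz⟩ := hsurj (etaPoint B)
  have hze : z = etaPoint B := hB.eq_etaPoint_of_le fun n hn => hle z n (by rw [hz]; exact hn)
  rw [hze] at hz
  refine hσ.eq_id_of_forall_window fun x n => ?_
  obtain ⟨_, ⟨r, rfl⟩, hr⟩ := mem_closure_iff_forall_window.1 x.2 n
  exact ⟨shiftPow (freeSubshift B) r (etaPoint B), by rw [hσ.map_shiftPow, hz], hr⟩

/-- If `σ x ≠ x`, then `σ x` has smaller support and is fixed by induction; so `x` and `σ x` share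
an image and differ at finitely many places. -/
theorem IsPreInjective.map_eq_self_of_finite (hinj : IsPreInjective (freeSubshift B) σ)
    (hle : ∀ x n, (σ x).1 n = true → x.1 n = true) (k : ℕ) :
    ∀ x : (freeSubshift B).carrier, {n : ℤ | x.1 n = true}.Finite →
      {n : ℤ | x.1 n = true}.ncard = k → σ x = x := by
  induction k using Nat.strong_induction_on with
  | _ k ih =>
    intro x hfin hk
    by_contra hne
    have hsub : {n : ℤ | (σ x).1 n = true} ⊆ {n : ℤ | x.1 n = true} := fun n hn => hle x n hn
    have hssub : {n : ℤ | (σ x).1 n = true} ⊂ {n : ℤ | x.1 n = true} := by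
      refine hsub.ssubset_of_ne fun h => hne (Subtype.ext (funext fun n => ?_))
      exact Bool.eq_iff_iff.2 (Set.ext_iff.1 h n)
    have hfix := ih _ (hk ▸ Set.ncard_lt_ncard hssub hfin) (σ x) (hfin.subset hsub) rfl
    refine hne (hinj _ _ hfix (hfin.subset fun n hn => ?_))
    by_contra hxn
    exact hn (Bool.eq_iff_iff.2 ⟨fun h => hle x n h, fun h => absurd h hxn⟩)

theorem IsErdos.eq_id_of_isPreInjective (hB : IsErdos B)
    (hσ : IsCellularAutomaton (freeSubshift B) σ)
    (hle : ∀ x n, (σ x).1 n = true → x.1 n = true)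
    (hinj : IsPreInjective (freeSubshift B) σ) : ∀ x, σ x = x := by
  refine hσ.eq_id_of_forall_window fun x n => ?_
  -- By heredity, truncating `x` to a window stays in the subshift.
  have hmem : (fun j : ℤ => decide (j.natAbs ≤ n) && x.1 j) ∈ (freeSubshift B).carrier :=
    hB.mem_freeSubshift_of_le x.2 fun j hj => ((Bool.and_eq_true _ _).mp hj).2
  refine ⟨⟨_, hmem⟩, hinj.map_eq_self_of_finite hle _ _ ?_ rfl, fun j hj => by simp [hj]⟩
  refine (Set.finite_Icc (-(n : ℤ)) n).subset fun j hj => ?_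
  have h := of_decide_eq_true ((Bool.and_eq_true _ _).mp hj).1
  exact ⟨by omega, by omega⟩

open Classical in
theorem IsCellularAutomaton.exists_monotoneCode (hσ : IsCellularAutomaton (freeSubshift B) σ)
    (hle : ∀ x n, (σ x).1 n = true → x.1 n = true) :
    ∃ (ℓ : ℕ) (φ : Block ℓ → Bool), IsMonotoneCode φ ∧ ∀ x, (σ x).1 = codeMap φ x.1 := by
  obtain ⟨ℓ, hℓ⟩ := hσ.exists_window
  -- The factor `w.center` gives monotonicity on blocks that do not occur in the subshift too.
  refine ⟨ℓ, fun w => w.center && decide (∃ x : (freeSubshift B).carrier,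
    (∀ i : Set.Icc (-(ℓ : ℤ)) (ℓ : ℤ), x.1 i = w i) ∧ (σ x).1 0 = true),
    fun w => Bool.and_le_left _ _, fun x => funext fun n => ?_⟩
  have hshift : (σ (shiftPow (freeSubshift B) n x)).1 0 = (σ x).1 n := by
    rw [hσ.map_shiftPow]
    change (σ x).1 (n + 0) = _
    rw [add_zero]
  rw [Bool.eq_iff_iff, codeMap, Bool.and_eq_true, decide_eq_true_iff]
  constructor
  · intro h
    refine ⟨?_, shiftPow (freeSubshift B) n x, fun i => rfl, hshift.trans h⟩
    change x.1 (n + 0) = true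
    rw [add_zero]
    exact hle x n h
  · rintro ⟨-, y, hy, hy0⟩
    rw [← hshift, ← hy0]
    refine hℓ _ _ 0 fun j hj => ?_
    rw [zero_add]
    exact (hy ⟨j, by omega, by omega⟩).symm

end Decreasing

end BFree

/-! ### The theorem -/

theorem theorem1 (B : Set ℕ) (hB : BFree.IsErdos B) :
    BFree.SatisfiesGardenOfEden (BFree.freeSubshift B) ∧
    ∀ τ : (BFree.freeSubshift B).carrier → (BFree.freeSubshift B).carrier,
      BFree.IsCellularAutomaton (BFree.freeSubshift B) τ →
        (∃ (t : ℤ) (ℓ : ℕ) (φ : BFree.Block ℓ → Bool), BFree.IsMonotoneCode φ ∧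
          ∀ x : (BFree.freeSubshift B).carrier,
            (τ x : ℤ → Bool) =
              SymbolicDynamics.FullShift.shift t (BFree.codeMap φ (x : ℤ → Bool))) ∧
        (Function.Surjective τ → ∃ t : ℤ, τ = BFree.shiftPow (BFree.freeSubshift B) t) := by
  let X := BFree.freeSubshift B
  have main : ∀ τ : X.carrier → X.carrier, BFree.IsCellularAutomaton X τ →
      ∃ (t : ℤ) (σ : X.carrier → X.carrier), BFree.IsCellularAutomaton X σ ∧
        (∀ x n, (σ x).1 n = true → x.1 n = true) ∧
        σ = BFree.shiftPow X (-t) ∘ τ ∧ ∀ x, τ x = BFree.shiftPow X t (σ x) := by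
    intro τ hτ
    obtain ⟨t, ht⟩ := hB.exists_shift_dominating hτ
    refine ⟨t, _, hτ.shiftPow_comp (-t), fun x n hn => ?_, rfl,
      fun x => (BFree.shiftPow_shiftPow_neg X t _).symm⟩
    have h := ht x (-t + n) hn
    rwa [add_neg_cancel_left] at h
  have hsurj : ∀ τ : X.carrier → X.carrier, BFree.IsCellularAutomaton X τ →
      Function.Surjective τ → ∃ t : ℤ, τ = BFree.shiftPow X t := by
    intro τ hτ hs
    obtain ⟨t, σ, hσ, hle, hστ, hτσ⟩ := main τ hτ
    have hid := hB.eq_id_of_surjective hσ hle (by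
      rw [hστ]
      exact Function.Surjective.comp
        (fun x => ⟨_, BFree.shiftPow_neg_shiftPow X t x⟩) hs)
    exact ⟨t, funext fun x => by rw [hτσ, hid]⟩
  refine ⟨fun τ hτ => ⟨fun hs => ?_, fun hinj => ?_⟩, fun τ hτ => ⟨?_, hsurj τ hτ⟩⟩
  · obtain ⟨t, rfl⟩ := hsurj τ hτ hs
    intro x y hxy _
    rw [← BFree.shiftPow_neg_shiftPow X t x, hxy, BFree.shiftPow_neg_shiftPow]
  · obtain ⟨t, σ, hσ, hle, hστ, hτσ⟩ := main τ hτ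
    have hid := hB.eq_id_of_isPreInjective hσ hle fun x y hxy hfin =>
      hinj x y (by rw [hτσ, hxy, ← hτσ]) hfin
    exact fun x => ⟨_, by rw [hτσ, hid]; exact BFree.shiftPow_shiftPow_neg X t x⟩
  · obtain ⟨t, σ, hσ, hle, hστ, hτσ⟩ := main τ hτ
    obtain ⟨ℓ, φ, hφ, hcode⟩ := hσ.exists_monotoneCode hle
    refine ⟨t, ℓ, φ, hφ, fun x => ?_⟩
    rw [← hcode, hτσ]
    rfl
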